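/- Let $X,Y$ be real Banach spaces with a bounded injective linear inclusion $\iota:X\hookrightarrow Y$, let $U\subset X$ be open, and let $F:U\to Y$ be of class $C^3$. A real eigenvalue of a bounded operator $T:X\to Y$ is a number $\lambda\in\mathbb R$ with $T\phi=\lambda\,\iota\phi$ for some $\phi\neq0$ (an eigenvector); a complex eigenvalue is an eigenvalue, in the same sense, of the complexification of $T$. Fix $x\in U$ such that $DF(x)$ is a Fredholm operator of index zero whose kernel is spanned by a vector $k\in X$ with $\iota k\notin\operatorname{Ran}DF(x)$ (so $k\ne0$ and $0$ is an eigenvalue). Then there are an open ball $B\subset\mathcal B(X,Y)$ centered at $DF(x)$ and maps $\lambda_s:B\to\mathbb R$, $\phi_s:B\to X$ such that: (1) every $T\in B$ is Fredholm of index zero and $\dim\operatorname{Ker}T\le1$; (2) for every $T\in B$, $\lambda_s(T)$ is an eigenvalue of $T$ and every other complex eigenvalue of $T$ has strictly larger modulus (so the eigenvalue of smallest modulus is unique and real); $\phi_s(T)$ is an eigenvector for $\lambda_s(T)$, it spans the eigenspace, and it is normalized by $\ell(\phi_s(T))=1$ for a fixed bounded linear functional $\ell$ on $X$. The maps $\lambda_s$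 and $\phi_s$ are real analytic on $B$; (3) for some open ball $B_x\subset U$ centered at $x$ one has $DF(\tilde x)\in B$ for $\tilde x\in B_x$, and the maps $\tilde x\mapsto\lambda_s(DF(\tilde x))\in\mathbb R$ and $\tilde x\mapsto\phi_s(DF(\tilde x))\in X$ are of class $C^2$ on $B_x$; more generally they are of class $C^n$ on $B_x$, for any $n\in\mathbb N$ for which $F$ is of class $C^{n+1}$ on $U$ (in particular of class $C^3$ if $F$ is of class $C^4$); (4) if the derivative at $x$ of $\tilde x\mapsto\lambda_s(DF(\tilde x))$ in the direction $\phi_s(DF(x))$ is nonzero, then $x$ is a fold of $F$: $F$ is not a local homeomorphism at $x$, and there are a real Banach space $Z$ and local $C^1$ changes of variables centered at $x$ and at $F(x)$ in which $F$ becomes $(t,z)\in\mathbb R\times Z\mapsto(t^2,z)\in\mathbb R\times Z$. -/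

import Mathlib

open Set Topology

universe u v

/-- A bounded operator is Fredholm of index zero: it is Fredholm and
`dim Ker T = dim (Y / Ran T)`. -/
def IsFredholmIndexZero {X : Type u} [NormedAddCommGroup X] [NormedSpace ℝ X]
    {Y : Type v} [NormedAddCommGroup Y] [NormedSpace ℝ Y] (T : X →L[ℝ] Y) : Prop :=
  T.IsFredholm ∧ (T : X →ₗ[ℝ] Y).index = 0

/-- `φ` is an eigenvector of `T : X → Y` for the real eigenvalue `r`, where `X` is regarded as
included in `Y` through `ι`: `φ ≠ 0` and `T φ = r φ`. -/
def IsEigenvector {X : Type u} [NormedAddCommGroup X] [NormedSpace ℝ X]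
    {Y : Type v} [NormedAddCommGroup Y] [NormedSpace ℝ Y]
    (ι T : X →L[ℝ] Y) (r : ℝ) (φ : X) : Prop :=
  φ ≠ 0 ∧ T φ = r • ι φ

/-- `z` is a (possibly non-real) eigenvalue of the real operator `T : X → Y`, that is, an eigenvalue
of its complexification: with `z = a + i b`, some `w = p + i q ≠ 0` satisfies
`T p + i T q = (a + i b) (ι p + i ι q)`. -/
def IsComplexEigenvalue {X : Type u} [NormedAddCommGroup X] [NormedSpace ℝ X]
    {Y : Type v} [NormedAddCommGroup Y] [NormedSpace ℝ Y]
    (ι T : X →L[ℝ] Y) (z : ℂ) : Prop :=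
  ∃ p q : X, (p ≠ 0 ∨ q ≠ 0) ∧
    T p = z.re • ι p - z.im • ι q ∧ T q = z.im • ι p + z.re • ι q

/-- The critical set of `F : U → Y`: the points of `U` at which `F` is not a local
homeomorphism. -/
def criticalSet {X : Type u} [TopologicalSpace X] {Y : Type v} [TopologicalSpace Y]
    (U : Set X) (F : X → Y) : Set X :=
  {x | x ∈ U ∧ ¬ ∃ e : OpenPartialHomeomorph X Y,
    x ∈ e.source ∧ e.source ⊆ U ∧ EqOn F e e.source}

/-- A local change of variables: a homeomorphism between open sets which is of class `C¹` together
with its inverse. -/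
def IsC1Change {E : Type u} [NormedAddCommGroup E] [NormedSpace ℝ E]
    {G : Type v} [NormedAddCommGroup G] [NormedSpace ℝ G]
    (e : OpenPartialHomeomorph E G) : Prop :=
  ContDiffOn ℝ 1 e e.source ∧ ContDiffOn ℝ 1 e.symm e.target

/-- The critical point `x` of `F : U → Y` is a fold: in suitable local changes of variables `α`
at `x` and `β` at `F x`, both centered (sending the base point to the origin), `F` becomes
`(t, z) ↦ (t ^ 2, z)` on `ℝ × Z`, for some real Banach space `Z`.
The universe of `Z` is no restriction, since `ℝ × Z` is isomorphic to `X`. -/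
def IsFold {X : Type u} [NormedAddCommGroup X] [NormedSpace ℝ X]
    {Y : Type v} [NormedAddCommGroup Y] [NormedSpace ℝ Y]
    (U : Set X) (F : X → Y) (x : X) : Prop :=
  x ∈ criticalSet U F ∧
  ∃ (Z : Type u) (_ : NormedAddCommGroup Z) (_ : NormedSpace ℝ Z) (_ : CompleteSpace Z)
    (α : OpenPartialHomeomorph X (ℝ × Z)) (β : OpenPartialHomeomorph Y (ℝ × Z)),
    IsC1Change α ∧ IsC1Change β ∧
    x ∈ α.source ∧ α.source ⊆ U ∧ MapsTo F α.source β.source ∧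
    α x = 0 ∧ β (F x) = 0 ∧
    ∀ y ∈ α.source, β (F y) = ((α y).1 ^ 2, (α y).2)

/-! Everything in (1)–(3) rests on the bordered operator `(v, m) ↦ (T₀ v - m • ι k, l v)`, where `T₀
= DF(x)` and `l k = 1`. Index zero and `ι k ∉ Ran T₀` make it an isomorphism
(`exists_equiv_bordered`). It is the partial derivative at `(k, 0)` of the normalized eigenvalue
equation, so the implicit function theorem gives an analytic eigenpair near `T₀`. Its bounded
inverse also gives uniqueness: after subtracting multiples of the eigenvector on the branch, a
complex eigenvector with small eigenvalue solves a small perturbation of the bordered system with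
zero data (`exists_pos_bordered_unique`). Index zero persists because `T + l ⊗ ι k` stays
invertible.

For the fold, the functional `l ∘ A⁻¹`, with `A = T₀ + l ⊗ ι k`, vanishes on `Ran T₀` and is `1` at
`ι k`. Differentiating the eigenvalue equation shows that the hypothesis of (4) says `l (A⁻¹ (D²F(x)
k k)) ≠ 0`. A Lyapunov–Schmidt reduction turns `F` into `(t, z) ↦ (h (t, z), z)` with `∂ₜh = 0` and
`∂ₜ²h ≠ 0` at the origin, and `exists_eq_add_mul_sq` completes the square in `t`, with `z` as
parameter. -/

/-! ### Rank one perturbations and bordered operators -/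

section Linear

variable {X : Type u} [NormedAddCommGroup X] [NormedSpace ℝ X]
  {Y : Type v} [NormedAddCommGroup Y] [NormedSpace ℝ Y]

/-- The kernel of a rank one perturbation of an isomorphism is at most one-dimensional. -/
theorem finrank_ker_sub_smulRight_le_one (A : X ≃L[ℝ] Y) (l : X →L[ℝ] ℝ) (y : Y) :
    Module.finrank ℝ ((A : X →L[ℝ] Y) - l.smulRight y).ker ≤ 1 := by
  have hle : ((A : X →L[ℝ] Y) - l.smulRight y).ker ≤ Submodule.span ℝ {A.symm y} := by
    intro v hv
    have h : A v = l v • y := by simpa [sub_eq_zero] using hv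
    refine Submodule.mem_span_singleton.2 ⟨l v, ?_⟩
    rw [← map_smul, ← h, A.symm_apply_apply]
  exact (Submodule.finrank_mono hle).trans (finrank_span_le_card {A.symm y} |>.trans (by simp))

open scoped LinearMap.FiniteRangeSetoid in
/-- A rank one perturbation of an isomorphism is Fredholm of index zero. -/
theorem isFredholmIndexZero_sub_smulRight (A : X ≃L[ℝ] Y) (l : X →L[ℝ] ℝ) (y : Y) :
    IsFredholmIndexZero ((A : X →L[ℝ] Y) - l.smulRight y) := by
  set T : X →L[ℝ] Y := (A : X →L[ℝ] Y) - l.smulRight y with hT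
  have hTv : ∀ v, T v = A v - l v • y := fun v => by simp [hT]
  refine ⟨ContinuousLinearMap.IsFredholm.of_isQuasiInverse
    (v := (A.symm : Y →L[ℝ] X)) ?_, ?_⟩
  · have h1 : A.toLinearEquiv.symm.toLinearMap.IsQuasiInverse A.toLinearEquiv.toLinearMap :=
      A.toLinearEquiv.isQuasiInverse
    refine h1.congr (Setoid.refl _) ?_
    -- `T` and `A` agree on `l.ker`, of finite codimension, so `A.symm` inverts `T` modulo finite
    -- rank.
    refine LinearMap.FiniteRangeSetoid.equiv_of_eqOn_coFG (A := l.ker) ?_ ?_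
    · exact Module.Finite.equiv (l : X →ₗ[ℝ] ℝ).quotKerEquivRange.symm
    · intro v hv
      have : l v = 0 := hv
      change T v = A v
      rw [hTv, this, zero_smul, sub_zero]
  · rw [LinearMap.index_eq_finrank_sub]
    -- `1 - l (A.symm y)` acts as the determinant of `T`. If it vanishes, kernel dimension and range
    -- codimension are both one; otherwise `T` is bijective.
    by_cases h1 : l (A.symm y) = 1
    · have hy : A.symm y ≠ 0 := fun h => by simp [h] at h1
      have hker : (T : X →ₗ[ℝ] Y).ker = Submodule.span ℝ {A.symm y} := by
        ext v
        rw [Submodule.mem_span_singleton, LinearMap.mem_ker]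
        change T v = 0 ↔ _
        rw [hTv, sub_eq_zero]
        constructor
        · intro h
          exact ⟨l v, by rw [← map_smul, ← h, A.symm_apply_apply]⟩
        · rintro ⟨c, rfl⟩
          simp [h1]
      let g : Y →ₗ[ℝ] ℝ := (l ∘L (A.symm : Y →L[ℝ] X) : Y →L[ℝ] ℝ)
      have hg : ∀ z, g z = l (A.symm z) := fun z => rfl
      have hran : (T : X →ₗ[ℝ] Y).range = g.ker := by
        ext z
        rw [LinearMap.mem_range, LinearMap.mem_ker, hg]
        constructor
        · rintro ⟨v, rfl⟩
          change l (A.symm (T v)) = 0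
          rw [hTv]; simp [h1]
        · intro hz
          refine ⟨A.symm z, ?_⟩
          change T _ = z
          rw [hTv]; simp [hz]
      have hgs : Function.Surjective g := by
        intro c
        exact ⟨c • y, by rw [map_smul, hg, h1]; simp⟩
      have e := (g.quotKerEquivOfSurjective hgs).finrank_eq
      rw [hker, hran, finrank_span_singleton hy, e]
      simp
    · have h1' : 1 - l (A.symm y) ≠ 0 := fun h => h1 (by linarith)
      have hbij : Function.Bijective (T : X →ₗ[ℝ] Y) := by
        constructor
        · rw [← LinearMap.ker_eq_bot, LinearMap.ker_eq_bot']
          intro v hv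
          have hv' : T v = 0 := hv
          rw [hTv, sub_eq_zero] at hv'
          have h2 : v = l v • A.symm y := by
            rw [← map_smul, ← hv', A.symm_apply_apply]
          have h3 : l v = l v * l (A.symm y) := by
            conv_lhs => rw [h2]
            simp
          have h4 : l v = 0 := by
            have : l v * (1 - l (A.symm y)) = 0 := by linarith
            exact (mul_eq_zero.1 this).resolve_right h1'
          rw [h2, h4, zero_smul]
        · intro z
          -- The Sherman–Morrison formula.
          refine ⟨A.symm z + (l (A.symm z) / (1 - l (A.symm y))) • A.symm y, ?_⟩
          change T _ = z
          rw [hTv]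
          simp only [map_add, map_smul, ContinuousLinearEquiv.apply_symm_apply, smul_eq_mul]
          rw [add_sub_assoc, ← sub_smul, add_eq_left]
          have : l (A.symm z) / (1 - l (A.symm y)) -
            (l (A.symm z) + l (A.symm z) / (1 - l (A.symm y)) * l (A.symm y)) = 0 := by
            field_simp
            ring
          rw [this, zero_smul]
      have := LinearEquiv.index_eq_zero (e := LinearEquiv.ofBijective (T : X →ₗ[ℝ] Y) hbij)
      rw [← LinearMap.index_eq_finrank_sub]
      exact this

/-- If `T` has index zero, one-dimensional kernel and `w` lies outside its range, then the range of
`T` and `w` together span. -/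
theorem exists_apply_add_smul_eq {T : X →L[ℝ] Y} (hT : IsFredholmIndexZero T) {k : X} {w : Y}
    (hk : k ≠ 0) (hker : T.ker = Submodule.span ℝ {k}) (hw : w ∉ T.range) (y : Y) :
    ∃ (u : X) (d : ℝ), y = T u + d • w := by
  have h := hT.2
  rw [LinearMap.index_eq_finrank_sub] at h
  have hk1 : Module.finrank ℝ (T : X →ₗ[ℝ] Y).ker = 1 := by
    rw [show (T : X →ₗ[ℝ] Y).ker = Submodule.span ℝ {k} from hker, finrank_span_singleton hk]
  have hq : Module.finrank ℝ (Y ⧸ (T : X →ₗ[ℝ] Y).range) = 1 := by omega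
  have hw0 : (T : X →ₗ[ℝ] Y).range.mkQ w ≠ 0 := by
    simpa using hw
  obtain ⟨d, hd⟩ := (finrank_eq_one_iff_of_nonzero' _ hw0).1 hq ((T : X →ₗ[ℝ] Y).range.mkQ y)
  have h0 : (T : X →ₗ[ℝ] Y).range.mkQ (y - d • w) = 0 := by
    rw [map_sub, map_smul, hd, sub_self]
  have : y - d • w ∈ (T : X →ₗ[ℝ] Y).range := by
    rwa [Submodule.mkQ_apply, Submodule.Quotient.mk_eq_zero] at h0
  obtain ⟨u, hu⟩ := this
  exact ⟨u, d, by rw [show T u = y - d • w from hu]; abel⟩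

/-- Uniqueness for the bordered eigenvalue problem of a complexified operator, locally uniformly in
the operator, the bordering vector and the complex spectral parameter `a + i b`. -/
theorem exists_pos_bordered_unique (ι : X →L[ℝ] Y) {T₀ : X →L[ℝ] Y} {k : X} {l : X →L[ℝ] ℝ}
    (L : (X × ℝ) ≃L[ℝ] (Y × ℝ)) (hL : ∀ v m, L (v, m) = (T₀ v - m • ι k, l v)) :
    ∃ ε > 0, ∀ (T : X →L[ℝ] Y) (φ : X) (a b : ℝ), ‖T - T₀‖ < ε → ‖φ - k‖ < ε →
      |a| < ε → |b| < ε → ∀ (p q : X) (m n : ℝ), l p = 0 → l q = 0 →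
      T p = a • ι p - b • ι q + m • ι φ → T q = b • ι p + a • ι q + n • ι φ →
      p = 0 ∧ q = 0 ∧ m = 0 ∧ n = 0 := by
  set C := ‖(L.symm : (Y × ℝ) →L[ℝ] (X × ℝ))‖ with hC
  have hest : ∀ v m, l v = 0 → max ‖v‖ |m| ≤ C * ‖T₀ v - m • ι k‖ := by
    intro v m hv
    have h := (L.symm : (Y × ℝ) →L[ℝ] (X × ℝ)).le_opNorm (T₀ v - m • ι k, 0)
    have h2 : L.symm (T₀ v - m • ι k, 0) = (v, m) := by
      rw [← hv, ← hL, L.symm_apply_apply]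
    have h3 : ‖((T₀ v - m • ι k, 0) : Y × ℝ)‖ = ‖T₀ v - m • ι k‖ := by
      simp [Prod.norm_def]
    rw [h3, ContinuousLinearEquiv.coe_coe, h2, Prod.norm_def, Real.norm_eq_abs] at h
    exact h
  have hC0 : 0 ≤ C := norm_nonneg _
  set K := ‖ι‖ with hK
  have hK0 : 0 ≤ K := norm_nonneg _
  -- Each of the four unknowns will be at most `C * ε * (1 + 2 * K) * S`, with `S` the sum of their
  -- norms. This `ε` gives `S ≤ C / (C + 1) * S`, hence `S = 0`; `C + 1` also covers `C = 0`.
  refine ⟨1 / (4 * (C + 1) * (1 + 2 * K)), by positivity, ?_⟩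
  intro T φ a b hT hφ ha hb p q m n hp hq h1 h2
  set ε := 1 / (4 * (C + 1) * (1 + 2 * K)) with hε
  have hε0 : 0 < ε := by positivity
  set S := ‖p‖ + ‖q‖ + |m| + |n| with hS
  have hS0 : 0 ≤ S := by positivity
  have hιp : ∀ v, ‖ι v‖ ≤ K * ‖v‖ := ι.le_opNorm
  have key : ∀ (v v' : X) (c d e : ℝ), ‖v‖ + ‖v'‖ + |e| ≤ S → |c| ≤ ε → |d| ≤ ε →
      ‖(T₀ - T) v + c • ι v + d • ι v' + e • ι (φ - k)‖ ≤ ε * (1 + 2 * K) * S := by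
    intro v v' c d e hve hc hd
    have e1 : ‖(T₀ - T) v‖ ≤ ε * ‖v‖ := by
      refine (ContinuousLinearMap.le_opNorm _ _).trans ?_
      rw [norm_sub_rev]
      gcongr
    have e2 : ‖c • ι v‖ ≤ ε * (K * ‖v‖) := by
      rw [norm_smul, Real.norm_eq_abs]; gcongr; exact hιp v
    have e3 : ‖d • ι v'‖ ≤ ε * (K * ‖v'‖) := by
      rw [norm_smul, Real.norm_eq_abs]; gcongr; exact hιp v'
    have e4 : ‖e • ι (φ - k)‖ ≤ ε * (K * |e|) := by
      rw [norm_smul, Real.norm_eq_abs]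
      have : ‖ι (φ - k)‖ ≤ K * ε := (hιp _).trans (by gcongr)
      calc |e| * ‖ι (φ - k)‖ ≤ |e| * (K * ε) := by gcongr
        _ = ε * (K * |e|) := by ring
    have e5 : ‖(T₀ - T) v + c • ι v + d • ι v' + e • ι (φ - k)‖ ≤
        ‖(T₀ - T) v‖ + ‖c • ι v‖ + ‖d • ι v'‖ + ‖e • ι (φ - k)‖ :=
      norm_add₄_le
    have e6 : ε * (K * (‖v‖ + ‖v'‖ + |e|)) ≤ ε * (K * S) := by gcongr
    have e7 : ε * ‖v‖ ≤ ε * S := by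
      gcongr
      have := norm_nonneg v'
      have := abs_nonneg e
      linarith
    have e8 : 0 ≤ ε * (K * S) := by positivity
    nlinarith
  -- Real and imaginary parts each satisfy the bordered equation of `T₀`, with every small term
  -- moved to the right.
  have f1 : T₀ p - m • ι k = (T₀ - T) p + a • ι p + (-b) • ι q + m • ι (φ - k) := by
    rw [sub_apply, h1, map_sub]; module
  have f2 : T₀ q - n • ι k = (T₀ - T) q + a • ι q + b • ι p + n • ι (φ - k) := by
    rw [sub_apply, h2, map_sub]; module
  have g1 := hest p m hp
  have g2 := hest q n hq
  rw [f1] at g1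
  rw [f2] at g2
  have n1 := norm_nonneg p
  have n2 := norm_nonneg q
  have n3 := abs_nonneg m
  have n4 := abs_nonneg n
  have k1 := key p q a (-b) m (by rw [hS]; linarith) ha.le (by rw [abs_neg]; exact hb.le)
  have k2 := key q p a b n (by rw [hS]; linarith) ha.le hb.le
  have j1 := g1.trans (mul_le_mul_of_nonneg_left k1 hC0)
  have j2 := g2.trans (mul_le_mul_of_nonneg_left k2 hC0)
  have hεv : ε * (1 + 2 * K) * (4 * (C + 1)) = 1 := by
    rw [hε]; field_simp
  have hfin : S ≤ 4 * (C * (ε * (1 + 2 * K) * S)) := by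
    have := (le_max_left _ _).trans j1
    have := (le_max_right _ _).trans j1
    have := (le_max_left _ _).trans j2
    have := (le_max_right _ _).trans j2
    rw [hS]; rw [hS] at *; linarith
  have hpos : 0 < ε * (1 + 2 * K) := by positivity
  have hS1 : S ≤ S - 4 * (ε * (1 + 2 * K)) * S := by nlinarith
  have hS2 : S = 0 := by
    refine le_antisymm ?_ hS0
    by_contra hne
    push Not at hne
    have : 0 < 4 * (ε * (1 + 2 * K)) * S := by positivity
    linarith
  rw [hS] at hS2
  exact ⟨norm_eq_zero.1 (by linarith), norm_eq_zero.1 (by linarith), abs_eq_zero.1 (by linarith),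
    abs_eq_zero.1 (by linarith)⟩

variable [CompleteSpace X] [CompleteSpace Y]

/-- The rank one correction of `T` that is an isomorphism. -/
theorem exists_equiv_add_smulRight {T : X →L[ℝ] Y} (hT : IsFredholmIndexZero T) {k : X} {w : Y}
    (hker : T.ker = Submodule.span ℝ {k}) (hw : w ∉ T.range)
    {l : X →L[ℝ] ℝ} (hl : l k = 1) :
    ∃ A : X ≃L[ℝ] Y, (A : X →L[ℝ] Y) = T + l.smulRight w := by
  have hk : k ≠ 0 := fun h => by simp [h] at hl
  have hTk : T k = 0 := by
    have : k ∈ T.ker := by rw [hker]; exact Submodule.mem_span_singleton_self k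
    exact this
  have hv : ∀ v, (T + l.smulRight w) v = T v + l v • w := fun v => by simp
  have hinj : (T + l.smulRight w).ker = ⊥ := by
    rw [eq_bot_iff]
    intro v h
    have h1 : T v + l v • w = 0 := by rw [← hv]; exact h
    have h2 : l v = 0 := by
      by_contra hne
      refine hw ⟨-(l v)⁻¹ • v, ?_⟩
      change T _ = w
      rw [map_smul, eq_neg_of_add_eq_zero_left h1, smul_neg, neg_smul, neg_neg, smul_smul,
        inv_mul_cancel₀ hne, one_smul]
    have h3 : v ∈ T.ker := by
      change T v = 0
      simpa [h2] using h1
    rw [hker] at h3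
    obtain ⟨c, rfl⟩ := Submodule.mem_span_singleton.1 h3
    have : c = 0 := by simpa [hl] using h2
    simp [this]
  have hsurj : (T + l.smulRight w).range = ⊤ := by
    rw [eq_top_iff]
    rintro y -
    obtain ⟨u, d, rfl⟩ := exists_apply_add_smul_eq hT hk hker hw y
    -- Moving along `k` leaves `T u` unchanged and brings the value of `l` to `d`.
    refine ⟨u + (d - l u) • k, ?_⟩
    change (T + l.smulRight w) _ = _
    rw [hv]
    simp [hTk, hl]
  exact ⟨ContinuousLinearEquiv.ofBijective _ hinj hsurj, by
    ext v; simp⟩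

/-- The bordered operator of `T` is an isomorphism. -/
theorem exists_equiv_bordered {T : X →L[ℝ] Y} (hT : IsFredholmIndexZero T) {k : X} {w : Y}
    (hker : T.ker = Submodule.span ℝ {k}) (hw : w ∉ T.range)
    {l : X →L[ℝ] ℝ} (hl : l k = 1) :
    ∃ L : (X × ℝ) ≃L[ℝ] (Y × ℝ), ∀ v m, L (v, m) = (T v - m • w, l v) := by
  obtain ⟨A, hA⟩ := exists_equiv_add_smulRight hT hker hw hl
  have hAv : ∀ v, A v = T v + l v • w := fun v => by
    have := congrArg (fun B : X →L[ℝ] Y => B v) hA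
    simpa using this
  have hTk : T k = 0 := by
    have : k ∈ T.ker := by rw [hker]; exact Submodule.mem_span_singleton_self k
    exact this
  have hAk : A k = w := by rw [hAv, hTk, hl]; simp
  have hk : A.symm w = k := by rw [← hAk, A.symm_apply_apply]
  -- To solve `T v - m • w = y`, `l v = c`, rewrite it as `A v = y + (m + c) • w`. As `A k = w`,
  -- this gives `v = A⁻¹ y + (m + c) • k`, and `l v = c` forces `m = -l (A⁻¹ y)`.
  refine ⟨ContinuousLinearEquiv.equivOfInverse
    (((T ∘L .fst ℝ X ℝ) - (ContinuousLinearMap.snd ℝ X ℝ).smulRight w).prod (l ∘L .fst ℝ X ℝ))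
    (((A.symm : Y →L[ℝ] X) ∘L .fst ℝ Y ℝ +
        (ContinuousLinearMap.snd ℝ Y ℝ - l ∘L (A.symm : Y →L[ℝ] X) ∘L .fst ℝ Y ℝ).smulRight k).prod
      (- (l ∘L (A.symm : Y →L[ℝ] X) ∘L .fst ℝ Y ℝ))) ?_ ?_, ?_⟩
  · rintro ⟨v, m⟩
    have h1 : A.symm (T v) = v - l v • k := by
      rw [← hk, ← map_smul, ← A.symm_apply_apply v, ← map_sub, A.symm_apply_apply, hAv]
      simp
    have h2 : v - l v • k - m • k + (l v + m) • k = v := by module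
    ext <;> simp [h1, h2, hk, hl]
  · rintro ⟨y, c⟩
    have h1 : T (A.symm y) = y - l (A.symm y) • w := by
      rw [eq_sub_iff_add_eq, ← hAv, A.apply_symm_apply]
    ext <;> simp [h1, hTk, hl]
  · intro v m
    simp

end Linear

/-! ### The analytic eigenpair of smallest modulus -/

section Spectral

variable {X : Type u} [NormedAddCommGroup X] [NormedSpace ℝ X] [CompleteSpace X]
  {Y : Type v} [NormedAddCommGroup Y] [NormedSpace ℝ Y] [CompleteSpace Y]

/-- A simple kernel vector continues analytically to a normalized eigenpair. -/
theorem exists_analyticAt_eigenpair (ι : X →L[ℝ] Y) {T₀ : X →L[ℝ] Y} {k : X} {l : X →L[ℝ] ℝ}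
    (L : (X × ℝ) ≃L[ℝ] (Y × ℝ)) (hL : ∀ v m, L (v, m) = (T₀ v - m • ι k, l v))
    (hk : T₀ k = 0) (hl : l k = 1) :
    ∃ (lam : (X →L[ℝ] Y) → ℝ) (φ : (X →L[ℝ] Y) → X),
      AnalyticAt ℝ lam T₀ ∧ AnalyticAt ℝ φ T₀ ∧ lam T₀ = 0 ∧ φ T₀ = k ∧
      ∀ᶠ T in 𝓝 T₀, T (φ T) = lam T • ι (φ T) ∧ l (φ T) = 1 := by
  let f : (X →L[ℝ] Y) × (X × ℝ) → Y × ℝ :=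
    fun q => (q.1 q.2.1 - q.2.2 • ι q.2.1, l q.2.1)
  -- Here `⊤` is the analytic order, above `∞`; the implicit function inherits it.
  have hf : ContDiff ℝ ⊤ f := by
    refine ContDiff.prodMk (ContDiff.sub ?_ ?_) ?_
    · exact contDiff_fst.clm_apply (contDiff_fst.comp contDiff_snd)
    · exact (contDiff_snd.comp contDiff_snd).smul
        (ι.contDiff.comp (contDiff_fst.comp contDiff_snd))
    · exact l.contDiff.comp (contDiff_fst.comp contDiff_snd)
  let u₀ : (X →L[ℝ] Y) × (X × ℝ) := (T₀, (k, 0))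
  have hfu : f u₀ = (0, 1) := by simp [f, u₀, hk, hl]
  have hcd : ContDiffAt ℝ ⊤ f u₀ := hf.contDiffAt
  have hpart : fderiv ℝ f u₀ ∘L .inr ℝ (X →L[ℝ] Y) (X × ℝ) = (L : (X × ℝ) →L[ℝ] (Y × ℝ)) := by
    have h1 : HasFDerivAt (fun p : X × ℝ => f (T₀, p))
        (fderiv ℝ f u₀ ∘L .inr ℝ (X →L[ℝ] Y) (X × ℝ)) (k, 0) := by
      have h2 : HasFDerivAt f (fderiv ℝ f u₀) (T₀, ((k, 0) : X × ℝ)) :=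
        (hf.differentiable (by simp)).differentiableAt.hasFDerivAt
      exact h2.comp (k, (0 : ℝ)) (hasFDerivAt_prodMk_right T₀ ((k, 0) : X × ℝ))
    have hfst : HasFDerivAt (fun p : X × ℝ => p.1) (.fst ℝ X ℝ) (k, 0) := hasFDerivAt_fst
    have hsnd : HasFDerivAt (fun p : X × ℝ => p.2) (.snd ℝ X ℝ) (k, 0) := hasFDerivAt_snd
    have h3 := ((T₀.hasFDerivAt.comp ((k, 0) : X × ℝ) hfst).sub
      (hsnd.smul (ι.hasFDerivAt.comp ((k, 0) : X × ℝ) hfst))).prodMk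
      (l.hasFDerivAt.comp ((k, 0) : X × ℝ) hfst)
    refine (h1.unique h3).trans ?_
    refine ContinuousLinearMap.ext ?_
    rintro ⟨v, m⟩
    rw [ContinuousLinearEquiv.coe_coe, hL]
    simp
  have hinv : (fderiv ℝ f u₀ ∘L .inr ℝ (X →L[ℝ] Y) (X × ℝ)).IsInvertible := ⟨L, hpart.symm⟩
  set g := hcd.implicitFunction (by simp) hinv with hg
  have hgc : ContDiffAt ℝ ⊤ g T₀ := hcd.contDiffAt_implicitFunction (by simp) hinv
  have hg0 : g T₀ = (k, 0) := hcd.implicitFunction_apply_self (by simp) hinv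
  have hge := hcd.eventually_apply_implicitFunction (by simp) hinv
  refine ⟨fun T => (g T).2, fun T => (g T).1, ?_, ?_, by simp [hg0], by simp [hg0], ?_⟩
  · exact ContDiffAt.analyticAt (contDiff_snd.contDiffAt.comp T₀ hgc)
  · exact ContDiffAt.analyticAt (contDiff_fst.contDiffAt.comp T₀ hgc)
  · filter_upwards [hge] with T hT
    rw [hfu, ← hg, Prod.ext_iff] at hT
    exact ⟨sub_eq_zero.1 hT.1, hT.2⟩

/-- Near an operator of index zero with simple kernel there is an analytic normalized eigenpair whose
eigenvalue is the only complex one of smallest modulus. -/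
theorem exists_ball_smallest_eigenpair (ι : X →L[ℝ] Y) {T₀ : X →L[ℝ] Y}
    (hT₀ : IsFredholmIndexZero T₀) {k : X} (hker : T₀.ker = Submodule.span ℝ {k})
    (hran : ι k ∉ T₀.range) {l : X →L[ℝ] ℝ} (hl : l k = 1) :
    ∃ r > 0,
      (∀ T ∈ Metric.ball T₀ r, IsFredholmIndexZero T ∧ Module.finrank ℝ T.ker ≤ 1) ∧
      ∃ (lam : (X →L[ℝ] Y) → ℝ) (φ : (X →L[ℝ] Y) → X),
        (∀ T ∈ Metric.ball T₀ r, IsEigenvector ι T (lam T) (φ T) ∧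
          (∀ ψ : X, T ψ = lam T • ι ψ → ∃ c : ℝ, ψ = c • φ T) ∧
          ∀ z : ℂ, IsComplexEigenvalue ι T z → z ≠ (lam T : ℂ) → |lam T| < ‖z‖) ∧
        AnalyticOnNhd ℝ lam (Metric.ball T₀ r) ∧
        (∀ T ∈ Metric.ball T₀ r, l (φ T) = 1) ∧
        AnalyticOnNhd ℝ φ (Metric.ball T₀ r) ∧
        lam T₀ = 0 ∧ φ T₀ = k := by
  have hTk : T₀ k = 0 := by
    have : k ∈ T₀.ker := by rw [hker]; exact Submodule.mem_span_singleton_self k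
    exact this
  obtain ⟨A, hA⟩ := exists_equiv_add_smulRight hT₀ hker hran hl
  obtain ⟨L, hL⟩ := exists_equiv_bordered hT₀ hker hran hl
  obtain ⟨lam, φ, hlam, hφ, hlam0, hφ0, hev⟩ := exists_analyticAt_eigenpair ι L hL hTk hl
  obtain ⟨ε, hε, huniq⟩ := exists_pos_bordered_unique ι L hL
  -- Invertibility is open, so each nearby `T` is again an isomorphism minus the same rank one
  -- operator.
  have hinv : ∀ᶠ T in 𝓝 T₀, ∃ B : X ≃L[ℝ] Y, (B : X →L[ℝ] Y) = T + l.smulRight (ι k) := by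
    have hcont : Filter.Tendsto (fun T : X →L[ℝ] Y => T + l.smulRight (ι k)) (𝓝 T₀)
        (𝓝 (A : X →L[ℝ] Y)) := by
      rw [hA]
      exact (continuous_id.add continuous_const).tendsto T₀
    exact hcont (ContinuousLinearEquiv.nhds A)
  have hlamε : ∀ᶠ T in 𝓝 T₀, |lam T| < ε := by
    have := hlam.continuousAt.abs
    rw [ContinuousAt, hlam0, abs_zero] at this
    exact this.eventually_lt_const hε
  have hφε : ∀ᶠ T in 𝓝 T₀, ‖φ T - k‖ < ε := by
    have h1 := hφ.continuousAt
    rw [ContinuousAt, hφ0] at h1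
    filter_upwards [h1 (Metric.ball_mem_nhds k hε)] with T hT
    rwa [← dist_eq_norm]
  have hTε : ∀ᶠ T in 𝓝 T₀, ‖T - T₀‖ < ε := by
    filter_upwards [Metric.ball_mem_nhds T₀ hε] with T hT
    rwa [← dist_eq_norm]
  have hall := hinv.and (hlamε.and (hφε.and (hTε.and (hev.and
    (hlam.eventually_analyticAt.and hφ.eventually_analyticAt)))))
  obtain ⟨r, hr, hball⟩ := Metric.eventually_nhds_iff_ball.1 hall
  refine ⟨r, hr, ?_, lam, φ, ?_, ?_, ?_, ?_, hlam0, hφ0⟩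
  · intro T hT
    obtain ⟨B, hB⟩ := (hball T hT).1
    have : T = (B : X →L[ℝ] Y) - l.smulRight (ι k) := by rw [hB, add_sub_cancel_right]
    rw [this]
    exact ⟨isFredholmIndexZero_sub_smulRight B l (ι k),
      finrank_ker_sub_smulRight_le_one B l (ι k)⟩
  · intro T hT
    obtain ⟨-, h1, h2, h3, ⟨h4, h5⟩, -⟩ := hball T hT
    have h0 : φ T ≠ 0 := fun h => by simp [h] at h5
    refine ⟨⟨h0, h4⟩, ?_, ?_⟩
    · intro ψ hψ
      refine ⟨l ψ, ?_⟩
      have := (huniq T (φ T) (lam T) 0 h3 h2 h1 (by simpa using hε) (ψ - l ψ • φ T) 0 0 0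
        (by simp [h5]) (by simp) ?_ (by simp)).1
      · exact sub_eq_zero.1 this
      · simp only [map_sub, map_smul, hψ, h4, map_zero]
        module
    · rintro z ⟨p, q, hpq, hp, hq⟩ hz
      by_contra hlt
      push Not at hlt
      have hzε : ‖z‖ < ε := hlt.trans_lt h1
      -- Removing the `l`-components from `p + i q` leaves a vector in the kernel of `l`, at the
      -- cost of the term `(z - lam T) (l p + i l q) ι (φ T)`, whose coefficient has the real and
      -- imaginary parts supplied below. Uniqueness makes it vanish.
      obtain ⟨e1, e2, e3, e4⟩ := huniq T (φ T) z.re z.im h3 h2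
        ((Complex.abs_re_le_norm z).trans_lt hzε) ((Complex.abs_im_le_norm z).trans_lt hzε)
        (p - l p • φ T) (q - l q • φ T)
        ((z.re - lam T) * l p - z.im * l q) (z.im * l p + (z.re - lam T) * l q)
        (by simp [h5]) (by simp [h5])
        (by simp only [map_sub, map_smul, hp, h4]; module)
        (by simp only [map_sub, map_smul, hq, h4]; module)
      have hsq : ((z.re - lam T) ^ 2 + z.im ^ 2) * (l p ^ 2 + l q ^ 2) = 0 := by
        calc _ = ((z.re - lam T) * l p - z.im * l q) ^ 2 +
              (z.im * l p + (z.re - lam T) * l q) ^ 2 := by ring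
          _ = 0 := by rw [e3, e4]; ring
      rcases mul_eq_zero.1 hsq with h | h
      · apply hz
        apply Complex.ext
        · rw [Complex.ofReal_re]; nlinarith [sq_nonneg (z.re - lam T), sq_nonneg z.im]
        · rw [Complex.ofReal_im]; nlinarith [sq_nonneg (z.re - lam T), sq_nonneg z.im]
      · have hlp : l p = 0 := by nlinarith [sq_nonneg (l p), sq_nonneg (l q)]
        have hlq : l q = 0 := by nlinarith [sq_nonneg (l p), sq_nonneg (l q)]
        rw [hlp, zero_smul, sub_zero] at e1
        rw [hlq, zero_smul, sub_zero] at e2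
        exact hpq.elim (fun h => h e1) (fun h => h e2)
  · intro T hT
    exact (hball T hT).2.2.2.2.2.1
  · intro T hT
    exact (hball T hT).2.2.2.2.1.2
  · intro T hT
    exact (hball T hT).2.2.2.2.2.2

end Spectral

/-! ### Taylor remainders, local charts and the splitting lemma -/

section Analysis

/-- Taylor's formula of order two on `[0, 1]`. -/
theorem eq_add_add_integral_of_hasDerivAt {g g' g'' : ℝ → ℝ}
    (h1 : ∀ s ∈ Icc (0 : ℝ) 1, HasDerivAt g (g' s) s)
    (h2 : ∀ s ∈ Icc (0 : ℝ) 1, HasDerivAt g' (g'' s) s)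
    (h3 : ContinuousOn g'' (Icc 0 1)) :
    g 1 = g 0 + g' 0 + ∫ s in (0 : ℝ)..1, (1 - s) * g'' s := by
  have hG : ∀ s ∈ uIcc (0 : ℝ) 1,
      HasDerivAt (fun s => g s + (1 - s) * g' s) ((1 - s) * g'' s) s := by
    intro s hs
    rw [uIcc_of_le zero_le_one] at hs
    have h := (h1 s hs).add (((hasDerivAt_id s).const_sub 1).mul (h2 s hs))
    refine h.congr_deriv ?_
    simp
  have hint : IntervalIntegrable (fun s : ℝ => (1 - s) * g'' s) MeasureTheory.volume 0 1 := by
    refine ContinuousOn.intervalIntegrable ?_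
    rw [uIcc_of_le zero_le_one]
    exact (continuous_const.sub continuous_id).continuousOn.mul h3
  have := intervalIntegral.integral_eq_sub_of_hasDerivAt hG hint
  simp only [sub_self, zero_mul, add_zero, sub_zero, one_mul] at this
  linarith

/-- Averaging a `C¹` function over a path of contractions preserves `C¹` regularity at `0`. -/
theorem contDiffAt_one_integral_comp_contraction {E : Type*} [NormedAddCommGroup E]
    [NormedSpace ℝ E] {u : E → ℝ} (hu : ContDiffAt ℝ 1 u 0) {ρ : ℝ → ℝ} (hρ : Continuous ρ)
    {Λ : ℝ → E →L[ℝ] E} (hΛ : Continuous Λ) (hΛ1 : ∀ s ∈ Icc (0 : ℝ) 1, ‖Λ s‖ ≤ 1) :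
    ContDiffAt ℝ 1 (fun p => ∫ s in (0 : ℝ)..1, ρ s * u (Λ s p)) 0 := by
  obtain ⟨u', V, hV, hu'c, hu'⟩ := contDiffAt_one_iff.1 hu
  have hcat : ContinuousAt u' 0 := hu'c.continuousAt hV
  have hbd : ∀ᶠ p in 𝓝 (0 : E), ‖u' p‖ < ‖u' 0‖ + 1 :=
    hcat.norm.eventually_lt_const (lt_add_one _)
  -- Contractions preserve a ball centered at `0`, so a local bound on `u'` there dominates the
  -- integrand uniformly in `s`, without any compactness in `E`.
  obtain ⟨δ, hδ, hball⟩ := Metric.eventually_nhds_iff_ball.1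
    (hbd.and (eventually_mem_nhds_iff.2 hV))
  have hΛb : ∀ p ∈ Metric.ball (0 : E) δ, ∀ s ∈ Icc (0 : ℝ) 1, Λ s p ∈ Metric.ball (0 : E) δ := by
    intro p hp s hs
    rw [mem_ball_zero_iff] at hp ⊢
    refine lt_of_le_of_lt ?_ hp
    simpa using (Λ s).le_of_opNorm_le (hΛ1 s hs) p
  have hΛp : ∀ p, Continuous fun s => Λ s p := fun p => hΛ.clm_apply continuous_const
  have hIoc : ∀ s ∈ uIoc (0 : ℝ) 1, s ∈ Icc (0 : ℝ) 1 := by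
    intro s hs
    rw [uIoc_of_le zero_le_one] at hs
    exact Ioc_subset_Icc_self hs
  have hud : ∀ p ∈ Metric.ball (0 : E) δ, HasFDerivAt u (u' p) p := fun p hp =>
    hu' p (mem_of_mem_nhds (hball p hp).2)
  have hu'a : ∀ p ∈ Metric.ball (0 : E) δ, ContinuousAt u' p := fun p hp =>
    hu'c.continuousAt (hball p hp).2
  let G : E → ℝ → (E →L[ℝ] ℝ) := fun p s => ρ s • (u' (Λ s p) ∘L Λ s)
  have hFcont : ∀ p ∈ Metric.ball (0 : E) δ,
      ContinuousOn (fun s => ρ s * u (Λ s p)) (Icc 0 1) := by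
    intro p hp s hs
    have h1 : ContinuousAt u (Λ s p) := (hud _ (hΛb p hp s hs)).continuousAt
    have h2 : ContinuousAt (fun s => u (Λ s p)) s :=
      ContinuousAt.comp (f := fun s => Λ s p) h1 (hΛp p).continuousAt
    exact (hρ.continuousAt.mul h2).continuousWithinAt
  have hGcont : ∀ p ∈ Metric.ball (0 : E) δ, ContinuousOn (G p) (Icc 0 1) := by
    intro p hp s hs
    have h2 : ContinuousAt (fun s => u' (Λ s p)) s :=
      ContinuousAt.comp (f := fun s => Λ s p) (hu'a _ (hΛb p hp s hs)) (hΛp p).continuousAt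
    exact (hρ.continuousAt.smul (h2.clm_comp hΛ.continuousAt)).continuousWithinAt
  have hGbd : ∀ s ∈ uIoc (0 : ℝ) 1, ∀ p ∈ Metric.ball (0 : E) δ,
      ‖G p s‖ ≤ |ρ s| * (‖u' 0‖ + 1) := by
    intro s hs p hp
    have hs' := hIoc s hs
    rw [norm_smul, Real.norm_eq_abs]
    have h1 := (u' (Λ s p)).opNorm_comp_le (Λ s)
    have h2 := (hball _ (hΛb p hp s hs')).1.le
    have h3 := hΛ1 s hs'
    have h4 : ‖u' (Λ s p)‖ * ‖Λ s‖ ≤ (‖u' 0‖ + 1) * 1 := by gcongr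
    rw [mul_one] at h4
    exact mul_le_mul_of_nonneg_left (h1.trans h4) (abs_nonneg _)
  have hbdint : IntervalIntegrable (fun s => |ρ s| * (‖u' 0‖ + 1)) MeasureTheory.volume 0 1 :=
    (hρ.abs.mul continuous_const).intervalIntegrable _ _
  have hnh : ∀ p ∈ Metric.ball (0 : E) δ, Metric.ball (0 : E) δ ∈ 𝓝 p := fun p hp =>
    Metric.isOpen_ball.mem_nhds hp
  have hsub : uIoc (0 : ℝ) 1 ⊆ Icc 0 1 := hIoc
  refine contDiffAt_one_iff.2 ⟨fun p => ∫ s in (0 : ℝ)..1, G p s, Metric.ball 0 δ,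
    Metric.ball_mem_nhds 0 hδ, ?_, ?_⟩
  · intro p hp
    refine ContinuousAt.continuousWithinAt ?_
    refine intervalIntegral.continuousAt_of_dominated_interval
      (bound := fun s => |ρ s| * (‖u' 0‖ + 1)) ?_ ?_ hbdint ?_
    · filter_upwards [hnh p hp] with p' hp'
      exact ((hGcont p' hp').mono hsub).aestronglyMeasurable measurableSet_uIoc
    · filter_upwards [hnh p hp] with p' hp'
      exact Filter.Eventually.of_forall fun s hs => hGbd s hs p' hp'
    · refine Filter.Eventually.of_forall fun s hs => ?_
      have h2 : ContinuousAt (fun p => u' (Λ s p)) p :=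
        ContinuousAt.comp (f := fun p => Λ s p) (hu'a _ (hΛb p hp s (hIoc s hs)))
          (Λ s).continuous.continuousAt
      exact (h2.clm_comp continuousAt_const).const_smul (ρ s)
  · intro p hp
    refine intervalIntegral.hasFDerivAt_integral_of_dominated_of_fderiv_le
      (F' := G) (bound := fun s => |ρ s| * (‖u' 0‖ + 1)) (hnh p hp) ?_ ?_ ?_ ?_ hbdint ?_
    · filter_upwards [hnh p hp] with p' hp'
      exact ((hFcont p' hp').mono hsub).aestronglyMeasurable measurableSet_uIoc
    · refine ContinuousOn.intervalIntegrable ?_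
      rw [uIcc_of_le zero_le_one]
      exact hFcont p hp
    · exact ((hGcont p hp).mono hsub).aestronglyMeasurable measurableSet_uIoc
    · exact Filter.Eventually.of_forall hGbd
    · refine Filter.Eventually.of_forall fun s hs p' hp' => ?_
      exact ((hud _ (hΛb p' hp' s (hIoc s hs))).comp p' (Λ s).hasFDerivAt).const_mul (ρ s)

/-- The shear of `ℝ × Z` with first component `W`. -/
theorem exists_equiv_shear {Z : Type*} [NormedAddCommGroup Z] [NormedSpace ℝ Z]
    (W : ℝ × Z →L[ℝ] ℝ) (hW : W (1, 0) ≠ 0) :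
    ∃ M : (ℝ × Z) ≃L[ℝ] (ℝ × Z),
      (M : ℝ × Z →L[ℝ] ℝ × Z) = W.prod (ContinuousLinearMap.snd ℝ ℝ Z) := by
  have hsplit : ∀ p : ℝ × Z, W p = p.1 * W (1, 0) + W (0, p.2) := by
    intro p
    rw [← smul_eq_mul, ← map_smul, ← map_add]
    congr 1
    ext <;> simp
  refine ⟨ContinuousLinearEquiv.equivOfInverse (W.prod (ContinuousLinearMap.snd ℝ ℝ Z))
    (((W (1, 0))⁻¹ • (ContinuousLinearMap.fst ℝ ℝ Z -
      W ∘L ContinuousLinearMap.inr ℝ ℝ Z ∘L ContinuousLinearMap.snd ℝ ℝ Z)).prod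
        (ContinuousLinearMap.snd ℝ ℝ Z)) ?_ ?_, ?_⟩
  · rintro ⟨t, z⟩
    have := hsplit (t, z)
    ext
    · simp only [ContinuousLinearMap.prod_apply]
      simp
      rw [this]
      field_simp
      ring
    · simp
  · rintro ⟨t, z⟩
    ext
    · simp only [ContinuousLinearMap.prod_apply]
      rw [hsplit]
      simp
      field_simp
      ring
    · simp
  · rfl

/-- A `C¹` map with invertible derivative at a point is a local change of variables there. -/
theorem exists_isC1Change {E : Type u} [NormedAddCommGroup E] [NormedSpace ℝ E] [CompleteSpace E]
    {G : Type v} [NormedAddCommGroup G] [NormedSpace ℝ G] {f : E → G} {f' : E ≃L[ℝ] G} {a : E}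
    (hf : ContDiffAt ℝ 1 f a) (hf' : HasFDerivAt f (f' : E →L[ℝ] G) a) {V : Set E} (hV : V ∈ 𝓝 a) :
    ∃ e : OpenPartialHomeomorph E G, IsC1Change e ∧ a ∈ e.source ∧ e.source ⊆ V ∧
      ∀ y, e y = f y := by
  set e₀ := hf.toOpenPartialHomeomorph f hf' one_ne_zero with he₀
  have hcoe : ∀ y, e₀ y = f y := fun y => rfl
  have ha : a ∈ e₀.source := hf.mem_toOpenPartialHomeomorph_source hf' one_ne_zero
  have hinv : ContDiffAt ℝ 1 e₀.symm (f a) := hf.to_localInverse hf' one_ne_zero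
  -- `C¹` regularity at a point spreads to a neighborhood; shrinking the source makes both the map
  -- and its inverse `C¹` throughout.
  have h1 : ∀ᶠ y in 𝓝 a, ContDiffAt ℝ 1 f y := hf.eventually (by simp)
  have h2 : ∀ᶠ y in 𝓝 a, ContDiffAt ℝ 1 e₀.symm (f y) :=
    hf'.continuousAt.eventually (hinv.eventually (by simp))
  obtain ⟨O, hO, hOo, haO⟩ := mem_nhds_iff.1 (h1.and (h2.and hV))
  refine ⟨e₀.restrOpen O hOo, ⟨?_, ?_⟩, ⟨ha, haO⟩, fun y hy => (hO hy.2).2.2, fun y => rfl⟩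
  · intro y hy
    exact (hO hy.2).1.contDiffWithinAt
  · intro y hy
    have hy' := (e₀.restrOpen O hOo).map_target hy
    have hyy : f ((e₀.restrOpen O hOo).symm y) = y := (e₀.restrOpen O hOo).right_inv hy
    have := (hO hy'.2).2.1
    rw [hyy] at this
    exact this.contDiffWithinAt

/-- Splitting lemma with parameters: a `C³` function with a nondegenerate critical point in the
first variable is a `C¹` function of the parameter plus or minus a `C¹` square. -/
theorem exists_eq_add_mul_sq {Z : Type*} [NormedAddCommGroup Z] [NormedSpace ℝ Z] [CompleteSpace Z]
    {h : ℝ × Z → ℝ} (hh : ContDiffAt ℝ 3 h 0) (h1 : fderiv ℝ h 0 (1, 0) = 0)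
    (h2 : fderiv ℝ (fun p => fderiv ℝ h p (1, 0)) 0 (1, 0) ≠ 0) :
    ∃ (σ : ℝ) (w : ℝ × Z → ℝ) (c : Z → ℝ), σ * σ = 1 ∧ ContDiffAt ℝ 1 w 0 ∧ ContDiffAt ℝ 1 c 0 ∧
      w 0 = 0 ∧ c 0 = h 0 ∧ fderiv ℝ w 0 (1, 0) ≠ 0 ∧
      ∀ᶠ p in 𝓝 (0 : ℝ × Z), h p = c p.2 + σ * w p ^ 2 := by
  set u₁ : ℝ × Z → ℝ := fun p => fderiv ℝ h p (1, 0) with hu₁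
  set u₂ : ℝ × Z → ℝ := fun p => fderiv ℝ u₁ p (1, 0) with hu₂
  have hu₁c : ContDiffAt ℝ 2 u₁ 0 :=
    (hh.fderiv_right (m := 2) (by norm_num)).clm_apply contDiffAt_const
  have hu₂c : ContDiffAt ℝ 1 u₂ 0 :=
    (hu₁c.fderiv_right (m := 1) (by norm_num)).clm_apply contDiffAt_const
  set a := u₂ 0 with ha
  have ha0 : a ≠ 0 := h2
  -- the critical curve
  obtain ⟨τ, hτc, hτ0, hτ⟩ : ∃ τ : Z → ℝ, ContDiffAt ℝ 2 τ 0 ∧ τ 0 = 0 ∧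
      ∀ᶠ z in 𝓝 (0 : Z), u₁ (τ z, z) = 0 := by
    -- The factors are swapped because the implicit function solves for the second one.
    let f : Z × ℝ → ℝ := fun q => u₁ (q.2, q.1)
    have hf : ContDiffAt ℝ 2 f (0 : Z × ℝ) :=
      ContDiffAt.comp (g := u₁) (f := fun q : Z × ℝ => (q.2, q.1)) (0 : Z × ℝ) hu₁c
        (contDiffAt_snd.prodMk contDiffAt_fst)
    have hinv : (fderiv ℝ f (0 : Z × ℝ) ∘L .inr ℝ Z ℝ).IsInvertible := by
      refine ⟨ContinuousLinearEquiv.unitsEquivAut ℝ (Units.mk0 a ha0), ?_⟩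
      have e1 : HasFDerivAt u₁ (fderiv ℝ u₁ 0) ((fun q : Z × ℝ => (q.2, q.1)) 0) :=
        (hu₁c.differentiableAt (by norm_num)).hasFDerivAt
      have e2 : HasFDerivAt (fun q : Z × ℝ => (q.2, q.1))
          ((ContinuousLinearMap.snd ℝ Z ℝ).prod (ContinuousLinearMap.fst ℝ Z ℝ)) 0 :=
        hasFDerivAt_snd.prodMk hasFDerivAt_fst
      have e3 : fderiv ℝ f 0 = fderiv ℝ u₁ 0 ∘L
          ((ContinuousLinearMap.snd ℝ Z ℝ).prod (ContinuousLinearMap.fst ℝ Z ℝ)) :=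
        (HasFDerivAt.comp (g := u₁) (f := fun q : Z × ℝ => (q.2, q.1)) (0 : Z × ℝ) e1 e2).fderiv
      rw [e3]
      ext
      simp [ha, hu₂]
    refine ⟨hf.implicitFunction (by norm_num) hinv,
      hf.contDiffAt_implicitFunction (by norm_num) hinv,
      hf.implicitFunction_apply_self (by norm_num) hinv, ?_⟩
    filter_upwards [hf.eventually_apply_implicitFunction (by norm_num) hinv] with z hz
    exact hz.trans h1
  have hτc' : ContDiffAt ℝ 2 (fun p : ℝ × Z => τ p.2) 0 :=
    ContDiffAt.comp (g := τ) (f := fun p : ℝ × Z => p.2) (0 : ℝ × Z) hτc contDiffAt_snd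
  -- `m` carries `{0} × Z` to the critical curve `t = τ z`; `n` undoes it.
  set m : ℝ × Z → ℝ × Z := fun p => (p.1 + τ p.2, p.2) with hm
  set n : ℝ × Z → ℝ × Z := fun p => (p.1 - τ p.2, p.2) with hn
  have hm0 : m 0 = 0 := by simp [hm, hτ0]
  have hn0 : n 0 = 0 := by simp [hn, hτ0]
  have hmc : ContDiffAt ℝ 2 m 0 := (contDiffAt_fst.add hτc').prodMk contDiffAt_snd
  have hnc : ContDiffAt ℝ 2 n 0 := (contDiffAt_fst.sub hτc').prodMk contDiffAt_snd
  have huc : ContDiffAt ℝ 1 (fun p => u₂ (m p)) 0 :=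
    ContDiffAt.comp (g := u₂) (0 : ℝ × Z) (by rw [hm0]; exact hu₂c) (hmc.of_le (by norm_num))
  let Λ : ℝ → (ℝ × Z) →L[ℝ] (ℝ × Z) := fun s =>
    s • (ContinuousLinearMap.inl ℝ ℝ Z ∘L ContinuousLinearMap.fst ℝ ℝ Z) +
      ContinuousLinearMap.inr ℝ ℝ Z ∘L ContinuousLinearMap.snd ℝ ℝ Z
  have hΛap : ∀ s p, Λ s p = (s * p.1, p.2) := fun s p => by simp [Λ]
  have hΛc : Continuous Λ := (continuous_id.smul continuous_const).add continuous_const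
  have hΛn : ∀ s ∈ Icc (0 : ℝ) 1, ‖Λ s‖ ≤ 1 := by
    intro s hs
    refine ContinuousLinearMap.opNorm_le_bound _ zero_le_one fun p => ?_
    rw [hΛap, one_mul, Prod.norm_def, Prod.norm_def, norm_mul, Real.norm_of_nonneg hs.1]
    exact max_le_max (mul_le_of_le_one_left (norm_nonneg _) hs.2) le_rfl
  -- The Taylor remainder in `t` about the critical curve, divided by `t ^ 2`. Keeping it as an
  -- integral, rather than a quotient, makes it `C¹` across `t = 0`.
  set q : ℝ × Z → ℝ := fun p => ∫ s in (0 : ℝ)..1, (1 - s) * u₂ (m (Λ s p)) with hq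
  have hqc : ContDiffAt ℝ 1 q 0 := contDiffAt_one_integral_comp_contraction
    (u := fun p => u₂ (m p)) huc (continuous_const.sub continuous_id) hΛc hΛn
  have hq0 : q 0 = a / 2 := by
    simp only [hq, map_zero, hm0, ← ha]
    rw [intervalIntegral.integral_mul_const, intervalIntegral.integral_sub (by simp) (by simp)]
    simp
    ring
  -- `σ` is the sign of `a`, so that `σ * q` has a `C¹` square root near the origin.
  obtain ⟨σ, hσ, hσa⟩ : ∃ σ : ℝ, σ * σ = 1 ∧ 0 < σ * a := by
    rcases lt_or_gt_of_ne ha0 with h | h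
    · exact ⟨-1, by norm_num, by linarith⟩
    · exact ⟨1, by norm_num, by linarith⟩
  have hqn : ContDiffAt ℝ 1 (fun p => σ * q (n p)) 0 :=
    contDiffAt_const.mul (ContDiffAt.comp (g := q) (0 : ℝ × Z) (by rw [hn0]; exact hqc)
      (hnc.of_le (by norm_num)))
  have hqn0 : 0 < σ * q (n 0) := by rw [hn0, hq0]; linarith
  have hsq : ContDiffAt ℝ 1 (fun p => √(σ * q (n p))) 0 := hqn.sqrt hqn0.ne'
  have hA : ContDiffAt ℝ 1 (fun p : ℝ × Z => p.1 - τ p.2) 0 :=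
    (contDiffAt_fst.sub hτc').of_le (by norm_num)
  refine ⟨σ, fun p => (p.1 - τ p.2) * √(σ * q (n p)), fun z => h (τ z, z), hσ, hA.mul hsq, ?_, ?_,
    ?_, ?_, ?_⟩
  · have e1 : ContDiffAt ℝ 1 (fun z => (τ z, z)) (0 : Z) :=
      (hτc.of_le (by norm_num)).prodMk contDiffAt_id
    refine ContDiffAt.comp (g := h) (0 : Z) ?_ e1
    rw [hτ0]
    exact hh.of_le (by norm_num)
  · simp [hτ0]
  · change h (τ 0, 0) = h 0
    rw [hτ0]; rfl
  · have e1 := ((hA.differentiableAt one_ne_zero).hasFDerivAt.mul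
      (hsq.differentiableAt one_ne_zero).hasFDerivAt).fderiv
    have e2 : fderiv ℝ (fun p : ℝ × Z => p.1 - τ p.2) 0 (1, 0) = 1 := by
      have e3 : HasFDerivAt (fun p : ℝ × Z => τ p.2)
          (fderiv ℝ τ 0 ∘L ContinuousLinearMap.snd ℝ ℝ Z) 0 :=
        HasFDerivAt.comp (g := τ) (f := fun p : ℝ × Z => p.2) (0 : ℝ × Z)
          (hτc.differentiableAt (by norm_num)).hasFDerivAt hasFDerivAt_snd
      have e4 : HasFDerivAt (fun p : ℝ × Z => p.1) (ContinuousLinearMap.fst ℝ ℝ Z) 0 :=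
        hasFDerivAt_fst
      rw [show fderiv ℝ (fun p : ℝ × Z => p.1 - τ p.2) 0 = _ from (e4.sub e3).fderiv]
      simp
    rw [show fderiv ℝ (fun p : ℝ × Z => (p.1 - τ p.2) * √(σ * q (n p))) 0 = _ from e1]
    simp only [add_apply, smul_apply, e2]
    simp only [Prod.fst_zero, Prod.snd_zero, hτ0, sub_zero, smul_eq_mul, zero_mul, zero_add,
      mul_one]
    exact (Real.sqrt_pos.2 hqn0).ne'
  · have d1 : ∀ᶠ p in 𝓝 (0 : ℝ × Z), DifferentiableAt ℝ h p :=
      (hh.eventually (by norm_num)).mono fun p hp => hp.differentiableAt (by norm_num)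
    have d2 : ∀ᶠ p in 𝓝 (0 : ℝ × Z), DifferentiableAt ℝ u₁ p :=
      (hu₁c.eventually (by norm_num)).mono fun p hp => hp.differentiableAt (by norm_num)
    have d3 : ∀ᶠ p in 𝓝 (0 : ℝ × Z), ContinuousAt u₂ p :=
      (hu₂c.eventually (by norm_num)).mono fun p hp => hp.continuousAt
    have hmt : Filter.Tendsto m (𝓝 0) (𝓝 0) := by
      have := hmc.continuousAt
      rwa [ContinuousAt, hm0] at this
    have hnt : Filter.Tendsto n (𝓝 0) (𝓝 0) := by
      have := hnc.continuousAt
      rwa [ContinuousAt, hn0] at this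
    obtain ⟨δ, hδ, hball⟩ := Metric.eventually_nhds_iff_ball.1
      (hmt.eventually (d1.and (d2.and d3)))
    have hsndt : Filter.Tendsto (fun p : ℝ × Z => p.2) (𝓝 0) (𝓝 0) := continuous_snd.tendsto 0
    filter_upwards [hnt.eventually (Metric.ball_mem_nhds 0 hδ), hsndt.eventually hτ,
      hqn.continuousAt.eventually_const_lt hqn0] with p hp hpτ hpq
    have hmem : ∀ s ∈ Icc (0 : ℝ) 1, Λ s (n p) ∈ Metric.ball (0 : ℝ × Z) δ := by
      intro s hs
      have hp' : n p ∈ Metric.ball (0 : ℝ × Z) δ := hp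
      rw [mem_ball_zero_iff] at hp' ⊢
      refine lt_of_le_of_lt ?_ hp'
      simpa using (Λ s).le_of_opNorm_le (hΛn s hs) (n p)
    set t := p.1 - τ p.2 with ht
    have hγ : ∀ s, m (Λ s (n p)) = (s * t + τ p.2, p.2) := fun s => by rw [hΛap]
    have hγd : ∀ s, HasDerivAt (fun s => m (Λ s (n p))) (t • ((1, 0) : ℝ × Z)) s := by
      intro s
      have e1 : HasDerivAt (fun s : ℝ => s * t + τ p.2) t s := by
        simpa using ((hasDerivAt_id s).mul_const t).add_const (τ p.2)
      have e2 := e1.prodMk (hasDerivAt_const s p.2)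
      simp only [hγ]
      simpa using e2
    -- Taylor along the segment from `(τ p.2, p.2)` to `p`; the linear term vanishes by the choice
    -- of `τ`.
    have key := eq_add_add_integral_of_hasDerivAt (g := fun s => h (m (Λ s (n p))))
      (g' := fun s => t * u₁ (m (Λ s (n p)))) (g'' := fun s => t * (t * u₂ (m (Λ s (n p)))))
      (fun s hs => ?_) (fun s hs => ?_) (fun s hs => ?_)
    · have i1 : m (Λ 1 (n p)) = p := by
        rw [hγ]; ext <;> simp [ht]
      have i0 : m (Λ 0 (n p)) = (τ p.2, p.2) := by
        rw [hγ]; simp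
      have i2 : ∫ s in (0 : ℝ)..1, (1 - s) * (t * (t * u₂ (m (Λ s (n p))))) = t ^ 2 * q (n p) := by
        rw [hq, ← intervalIntegral.integral_const_mul]
        congr 1
        funext s
        ring
      simp only [i1, i0, hpτ, i2] at key
      rw [key, mul_pow, Real.sq_sqrt hpq.le]
      linear_combination (-(t ^ 2 * q (n p))) * hσ
    · have := (hball _ (hmem s hs)).1.hasFDerivAt.comp_hasDerivAt s (hγd s)
      rwa [map_smul] at this
    · have := ((hball _ (hmem s hs)).2.1.hasFDerivAt.comp_hasDerivAt s (hγd s)).const_mul t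
      rwa [map_smul] at this
    · have := ContinuousAt.comp (f := fun s => m (Λ s (n p))) (hball _ (hmem s hs)).2.2
        (hγd s).continuousAt
      exact (continuousAt_const.mul (continuousAt_const.mul this)).continuousWithinAt

end Analysis

/-! ### Reduction to one variable and the fold normal form -/

section Fold

/-- A map which becomes `(t, z) ↦ (t ^ 2, z)` in local charts is not a local homeomorphism. -/
theorem mem_criticalSet_of_normalForm {X : Type u} [TopologicalSpace X] {Y : Type v}
    [TopologicalSpace Y] {Z : Type*} [NormedAddCommGroup Z] {U : Set X} {F : X → Y} {x : X}
    (hx : x ∈ U) (α : OpenPartialHomeomorph X (ℝ × Z)) (β : OpenPartialHomeomorph Y (ℝ × Z))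
    (hxα : x ∈ α.source) (hmap : MapsTo F α.source β.source) (hα0 : α x = 0)
    (hF : ∀ y ∈ α.source, β (F y) = ((α y).1 ^ 2, (α y).2)) :
    x ∈ criticalSet U F := by
  refine ⟨hx, ?_⟩
  rintro ⟨e, hxe, -, heq⟩
  have h0 : (0 : ℝ × Z) ∈ α.target := hα0 ▸ α.map_source hxα
  have hsymm0 : α.symm 0 = x := by rw [← hα0, α.left_inv hxα]
  have h1 : ∀ᶠ p in 𝓝 (0 : ℝ × Z), p ∈ α.target ∧ α.symm p ∈ e.source := by
    refine (α.open_target.eventually_mem h0).and ?_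
    refine (α.symm.continuousAt h0).eventually (e.open_source.mem_nhds ?_)
    rwa [hsymm0]
  have hplus : Filter.Tendsto (fun t : ℝ => ((t, 0) : ℝ × Z)) (𝓝 0) (𝓝 0) :=
    (by fun_prop : Continuous fun t : ℝ => ((t, 0) : ℝ × Z)).tendsto' _ _ rfl
  have hminus : Filter.Tendsto (fun t : ℝ => ((-t, 0) : ℝ × Z)) (𝓝 0) (𝓝 0) :=
    (by fun_prop : Continuous fun t : ℝ => ((-t, 0) : ℝ × Z)).tendsto' _ _ (by simp)
  have h2 := ((hplus.eventually h1).and (hminus.eventually h1)).filter_mono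
    (nhdsWithin_le_nhds (s := {(0 : ℝ)}ᶜ))
  -- The points `(t, 0)` and `(-t, 0)` have the same image arbitrarily close to the origin, which
  -- rules out local injectivity.
  obtain ⟨t, ⟨⟨ht1, ht2⟩, ht3, ht4⟩, ht0⟩ := (h2.and self_mem_nhdsWithin).exists
  have hs1 := α.map_target ht1
  have hs2 := α.map_target ht3
  have hβ : β (F (α.symm (t, 0))) = β (F (α.symm (-t, 0))) := by
    rw [hF _ hs1, hF _ hs2, α.right_inv ht1, α.right_inv ht3]
    simp
  have hFF := β.injOn (hmap hs1) (hmap hs2) hβ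
  rw [heq ht2, heq ht4] at hFF
  have hαα := α.symm.injOn ht1 ht3 (e.injOn ht2 ht4 hFF)
  have : t = -t := congrArg Prod.fst hαα
  exact ht0 (by rw [mem_singleton_iff]; linarith)

variable {X : Type u} [NormedAddCommGroup X] [NormedSpace ℝ X] [CompleteSpace X]
  {Y : Type v} [NormedAddCommGroup Y] [NormedSpace ℝ Y] [CompleteSpace Y]
  {Z : Type u} [NormedAddCommGroup Z] [NormedSpace ℝ Z] [CompleteSpace Z]

/-- If `DF x` is `(t, z) ↦ (0, z)` in linear coordinates and the first component of the second
derivative along the kernel does not vanish, then `x` is a fold. -/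
theorem isFold_of_fderiv_fderiv_ne_zero {U : Set X} (hU : IsOpen U) {F : X → Y}
    (hF : ContDiffOn ℝ 3 F U) {x : X} (hx : x ∈ U) (E : X ≃L[ℝ] (ℝ × Z)) (P : Y ≃L[ℝ] (ℝ × Z))
    (hEP : ∀ v, P (fderiv ℝ F x v) = (0, (E v).2))
    (hnd : (P (fderiv ℝ (fderiv ℝ F) x (E.symm (1, 0)) (E.symm (1, 0)))).1 ≠ 0) :
    IsFold U F x := by
  have hFx : ContDiffAt ℝ 3 F x := hF.contDiffAt (hU.mem_nhds hx)
  set k := E.symm (1, 0) with hk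
  have hEk : E k = (1, 0) := by rw [hk, E.apply_symm_apply]
  set g : X → ℝ × Z := fun y => P (F y - F x) with hg
  have hgc : ContDiffAt ℝ 3 g x := P.contDiff.contDiffAt.comp x (hFx.sub contDiffAt_const)
  have hgd : ∀ᶠ y in 𝓝 x, HasFDerivAt g ((P : Y →L[ℝ] ℝ × Z) ∘L fderiv ℝ F y) y := by
    filter_upwards [hFx.eventually (by norm_num)] with y hy
    exact P.hasFDerivAt.comp y
      ((hy.differentiableAt (by norm_num)).hasFDerivAt.sub_const (F x))
  have hg0 : g x = 0 := by simp [hg]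
  -- Lyapunov–Schmidt: taking the second component of `g` as a coordinate leaves only its first
  -- component to normalize. By `hEP` the derivative of `ψ` at `x` is `E`.
  set ψ : X → ℝ × Z := fun y => ((E (y - x)).1, (g y).2) with hψ
  have hψ0 : ψ x = 0 := by simp [hψ, hg0]
  have hψc : ContDiffAt ℝ 3 ψ x :=
    (contDiffAt_fst.comp x (E.contDiff.contDiffAt.comp x
      (contDiffAt_id.sub contDiffAt_const))).prodMk (contDiffAt_snd.comp x hgc)
  have hψd : HasFDerivAt ψ (E : X →L[ℝ] ℝ × Z) x := by
    have e1 : HasFDerivAt (fun y => (E (y - x)).1)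
        (ContinuousLinearMap.fst ℝ ℝ Z ∘L (E : X →L[ℝ] ℝ × Z)) x :=
      (ContinuousLinearMap.fst ℝ ℝ Z).hasFDerivAt.comp x
        (E.hasFDerivAt.comp x ((hasFDerivAt_id x).sub_const x))
    have e2 : HasFDerivAt (fun y => (g y).2) _ x :=
      (ContinuousLinearMap.snd ℝ ℝ Z).hasFDerivAt.comp x hgd.self_of_nhds
    refine (e1.prodMk e2).congr_fderiv ?_
    ext v <;> simp [hEP]
  set e₀ := hψc.toOpenPartialHomeomorph ψ hψd (by norm_num) with he₀
  have hxe₀ : x ∈ e₀.source := hψc.mem_toOpenPartialHomeomorph_source hψd (by norm_num)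
  set θ := e₀.symm with hθ
  have hθψ : ∀ᶠ y in 𝓝 x, θ (ψ y) = y := by
    filter_upwards [e₀.open_source.mem_nhds hxe₀] with y hy
    exact e₀.left_inv hy
  have hθ0 : θ 0 = x := by rw [← hψ0]; exact hθψ.self_of_nhds
  have hθc : ContDiffAt ℝ 3 θ 0 := by
    rw [← hψ0]; exact hψc.to_localInverse hψd (by norm_num)
  -- the reduced function
  set h : ℝ × Z → ℝ := fun p => (g (θ p)).1 with hh
  have hhψ : ∀ᶠ y in 𝓝 x, h (ψ y) = (g y).1 := by
    filter_upwards [hθψ] with y hy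
    rw [hh]; simp only [hy]
  have hhc : ContDiffAt ℝ 3 h 0 := by
    refine contDiffAt_fst.comp (0 : ℝ × Z) (ContDiffAt.comp (g := g) (0 : ℝ × Z) ?_ hθc)
    rwa [hθ0]
  have hh0 : h 0 = 0 := by simp [hh, hθ0, hg0]
  have hg1d : ∀ᶠ y in 𝓝 x, HasFDerivAt (fun y => (g y).1)
      (ContinuousLinearMap.fst ℝ ℝ Z ∘L (P : Y →L[ℝ] ℝ × Z) ∘L fderiv ℝ F y) y :=
    hgd.mono fun y hy => (ContinuousLinearMap.fst ℝ ℝ Z).hasFDerivAt.comp y hy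
  have hDh : fderiv ℝ h 0 = 0 := by
    have e1 : HasFDerivAt (fun y => (g y).1) (0 : X →L[ℝ] ℝ) (θ 0) := by
      rw [hθ0]
      refine hg1d.self_of_nhds.congr_fderiv ?_
      ext v
      simp [hEP]
    have e2 := (e1.comp (0 : ℝ × Z) (hθc.differentiableAt (by norm_num)).hasFDerivAt).fderiv
    rw [ContinuousLinearMap.zero_comp] at e2
    exact e2
  -- Differentiate `h ∘ ψ = (g ·).1` twice along `k`: the term with `D²ψ` drops since `Dh` vanishes
  -- at the origin, and `Dψ` at `x` sends `k` to `(1, 0)`.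
  have hD2 : fderiv ℝ (fderiv ℝ h) 0 (1, 0) (1, 0) = (P (fderiv ℝ (fderiv ℝ F) x k k)).1 := by
    have hdh : ∀ᶠ y in 𝓝 x, DifferentiableAt ℝ h (ψ y) := by
      have : Filter.Tendsto ψ (𝓝 x) (𝓝 0) := hψ0 ▸ hψd.continuousAt
      filter_upwards [this.eventually (hhc.eventually (by norm_num))] with y hy
      exact hy.differentiableAt (by norm_num)
    have hdψ : ∀ᶠ y in 𝓝 x, DifferentiableAt ℝ ψ y :=
      (hψc.eventually (by norm_num)).mono fun y hy => hy.differentiableAt (by norm_num)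
    have heq : (fun y => (P (fderiv ℝ F y k)).1) =ᶠ[𝓝 x]
        fun y => fderiv ℝ h (ψ y) (fderiv ℝ ψ y k) := by
      filter_upwards [hg1d, hdh, hdψ, hhψ.eventually_nhds] with y h1 h2 h3 h4
      have h5 : HasFDerivAt (fun y => (g y).1) _ y :=
        (h2.hasFDerivAt.comp y h3.hasFDerivAt).congr_of_eventuallyEq
          (h4.mono fun y' h' => h'.symm)
      exact congrArg (fun B : X →L[ℝ] ℝ => B k) (h1.unique h5)
    have hDF : HasFDerivAt (fderiv ℝ F) (fderiv ℝ (fderiv ℝ F) x) x :=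
      ((hFx.fderiv_right (m := 2) (by norm_num)).differentiableAt (by norm_num)).hasFDerivAt
    have hL : HasFDerivAt (fun y => (P (fderiv ℝ F y k)).1) _ x :=
      (ContinuousLinearMap.fst ℝ ℝ Z).hasFDerivAt.comp x (P.hasFDerivAt.comp x
        (hDF.clm_apply (hasFDerivAt_const k x)))
    have hDDh : HasFDerivAt (fderiv ℝ h) (fderiv ℝ (fderiv ℝ h) 0) (ψ x) := by
      rw [hψ0]
      exact ((hhc.fderiv_right (m := 2) (by norm_num)).differentiableAt (by norm_num)).hasFDerivAt
    have hDDψ : HasFDerivAt (fderiv ℝ ψ) (fderiv ℝ (fderiv ℝ ψ) x) x :=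
      ((hψc.fderiv_right (m := 2) (by norm_num)).differentiableAt (by norm_num)).hasFDerivAt
    have hR := (hDDh.comp x hψd).clm_apply (hDDψ.clm_apply (hasFDerivAt_const k x))
    have hu := congrArg (fun B : X →L[ℝ] ℝ => B k) (hL.unique (hR.congr_of_eventuallyEq heq))
    simpa [hψ0, hDh, hψd.fderiv, hEk] using hu.symm
  have hd2 : fderiv ℝ (fun p => fderiv ℝ h p (1, 0)) 0 (1, 0) ≠ 0 := by
    have hDDh : HasFDerivAt (fderiv ℝ h) (fderiv ℝ (fderiv ℝ h) 0) 0 :=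
      ((hhc.fderiv_right (m := 2) (by norm_num)).differentiableAt (by norm_num)).hasFDerivAt
    rw [(hDDh.clm_apply (hasFDerivAt_const ((1, 0) : ℝ × Z) 0)).fderiv]
    simpa [hD2] using hnd
  obtain ⟨σ, w, c, hσ, hwc, hcc, hw0, hc0, hwd, hev⟩ :=
    exists_eq_add_mul_sq hhc (by simp [hDh]) hd2
  -- the chart in the codomain
  obtain ⟨β, hβ, hβx, -, hβap⟩ : ∃ β : OpenPartialHomeomorph Y (ℝ × Z), IsC1Change β ∧
      F x ∈ β.source ∧ β.source ⊆ univ ∧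
      ∀ η, β η = (σ * ((P (η - F x)).1 - c (P (η - F x)).2), (P (η - F x)).2) := by
    -- Subtracting `c` flattens the image of the critical set, and `σ` makes the square positive.
    obtain ⟨M, hM⟩ := exists_equiv_shear
      (σ • (ContinuousLinearMap.fst ℝ ℝ Z - fderiv ℝ c 0 ∘L ContinuousLinearMap.snd ℝ ℝ Z))
      (by
        have : σ ≠ 0 := fun h => by simp [h] at hσ
        simpa using this)
    have hP0 : P (F x - F x) = 0 := by simp
    have hPd : HasFDerivAt (fun η => P (η - F x)) (P : Y →L[ℝ] ℝ × Z) (F x) :=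
      P.hasFDerivAt.comp (F x) ((hasFDerivAt_id (F x)).sub_const (F x))
    have hPc : ContDiffAt ℝ 1 (fun η => P (η - F x)) (F x) :=
      P.contDiff.contDiffAt.comp (F x) (contDiffAt_id.sub contDiffAt_const)
    have hBc : ContDiffAt ℝ 1 (fun p : ℝ × Z => (σ * (p.1 - c p.2), p.2)) 0 :=
      (contDiffAt_const.mul (contDiffAt_fst.sub
        (ContDiffAt.comp (g := c) (f := fun p : ℝ × Z => p.2) (0 : ℝ × Z) hcc
          contDiffAt_snd))).prodMk contDiffAt_snd
    have hBd : HasFDerivAt (fun p : ℝ × Z => (σ * (p.1 - c p.2), p.2))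
        (M : ℝ × Z →L[ℝ] ℝ × Z) 0 := by
      rw [hM]
      have e1 : HasFDerivAt (fun p : ℝ × Z => c p.2)
          (fderiv ℝ c 0 ∘L ContinuousLinearMap.snd ℝ ℝ Z) 0 :=
        HasFDerivAt.comp (g := c) (f := fun p : ℝ × Z => p.2) (0 : ℝ × Z)
          (hcc.differentiableAt one_ne_zero).hasFDerivAt hasFDerivAt_snd
      have e2 : HasFDerivAt (fun p : ℝ × Z => p.1) (ContinuousLinearMap.fst ℝ ℝ Z) 0 :=
        hasFDerivAt_fst
      exact ((e2.sub e1).const_mul σ).prodMk hasFDerivAt_snd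
    rw [← hP0] at hBc hBd
    exact exists_isC1Change (f' := P.trans M)
      (f := fun η => (σ * ((P (η - F x)).1 - c (P (η - F x)).2), (P (η - F x)).2))
      (hBc.comp (F x) hPc) (hBd.comp (F x) hPd) Filter.univ_mem
  -- the chart in the domain
  have hψt : Filter.Tendsto ψ (𝓝 x) (𝓝 0) := hψ0 ▸ hψd.continuousAt
  have hV : U ∩ {y | F y ∈ β.source ∧ h (ψ y) = (g y).1 ∧
      h (ψ y) = c (ψ y).2 + σ * w (ψ y) ^ 2} ∈ 𝓝 x := by
    refine Filter.inter_mem (hU.mem_nhds hx) ?_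
    exact (hFx.continuousAt.eventually (β.open_source.mem_nhds hβx)).and
      (hhψ.and (hψt.eventually hev))
  obtain ⟨α, hα, hxα, hαV, hαap⟩ : ∃ α : OpenPartialHomeomorph X (ℝ × Z), IsC1Change α ∧
      x ∈ α.source ∧ α.source ⊆ _ ∧ ∀ y, α y = (w (ψ y), (ψ y).2) := by
    obtain ⟨M, hM⟩ := exists_equiv_shear (fderiv ℝ w 0) hwd
    have hBc : ContDiffAt ℝ 1 (fun p : ℝ × Z => (w p, p.2)) 0 := hwc.prodMk contDiffAt_snd
    have hBd : HasFDerivAt (fun p : ℝ × Z => (w p, p.2)) (M : ℝ × Z →L[ℝ] ℝ × Z) 0 := by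
      rw [hM]
      exact (hwc.differentiableAt one_ne_zero).hasFDerivAt.prodMk hasFDerivAt_snd
    rw [← hψ0] at hBc hBd
    exact exists_isC1Change (f' := E.trans M) (f := fun y => (w (ψ y), (ψ y).2))
      (hBc.comp x (hψc.of_le (by norm_num))) (hBd.comp x hψd) hV
  have hmap : MapsTo F α.source β.source := fun y hy => (hαV hy).2.1
  have hα0 : α x = 0 := by rw [hαap, hψ0, hw0]; rfl
  have hform : ∀ y ∈ α.source, β (F y) = ((α y).1 ^ 2, (α y).2) := by
    intro y hy
    obtain ⟨-, -, h1, h2⟩ := hαV hy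
    rw [hβap, hαap]
    have h3 : (P (F y - F x)).1 = c (ψ y).2 + σ * w (ψ y) ^ 2 := h1.symm.trans h2
    refine Prod.ext ?_ rfl
    change σ * ((P (F y - F x)).1 - c (ψ y).2) = w (ψ y) ^ 2
    rw [h3]
    linear_combination w (ψ y) ^ 2 * hσ
  refine ⟨mem_criticalSet_of_normalForm hx α β hxα hmap hα0 hform, Z, inferInstance, inferInstance,
    inferInstance, α, β, hα, hβ, hxα, fun y hy => (hαV hy).1, hmap, hα0, ?_, hform⟩
  rw [hβap]
  simp [hc0, hh0]

end Fold

/-! ### Linear coordinates, the eigenvalue derivative and the main theorem -/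

/-- The splitting of `X` along `k` and the kernel of a functional `l` with `l k = 1`. -/
theorem exists_equiv_prod_ker {X : Type*} [NormedAddCommGroup X] [NormedSpace ℝ X]
    {l : X →L[ℝ] ℝ} {k : X} (hl : l k = 1) :
    ∃ E : X ≃L[ℝ] (ℝ × l.ker), ∀ v, (E v).1 = l v ∧ ((E v).2 : X) = v - l v • k := by
  let π : X →L[ℝ] l.ker := (ContinuousLinearMap.id ℝ X - l.smulRight k).codRestrict l.ker
    (fun v => by simp [hl])
  have hπ : ∀ v, (π v : X) = v - l v • k := fun v => rfl
  refine ⟨ContinuousLinearEquiv.equivOfInverse (l.prod π)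
    ((ContinuousLinearMap.fst ℝ ℝ l.ker).smulRight k +
      l.ker.subtypeL ∘L ContinuousLinearMap.snd ℝ ℝ l.ker) ?_ ?_, fun v => ⟨rfl, rfl⟩⟩
  · intro v
    simp [hπ]
  · rintro ⟨t, z⟩
    have hz : l (z : X) = 0 := z.2
    refine Prod.ext ?_ (Subtype.ext ?_)
    · simp [hl, hz]
    · simp [hπ, hl, hz]

/-- The derivative of a normalized eigenvalue branch at a simple zero eigenvalue: if `P` vanishes on
the range of `G x` and `P (ι (φ x)) = 1`, then it is `P (DG(x) v (φ x))`. -/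
theorem fderiv_eigenvalue_apply {X : Type*} [NormedAddCommGroup X] [NormedSpace ℝ X]
    {Y : Type*} [NormedAddCommGroup Y] [NormedSpace ℝ Y] (ι : X →L[ℝ] Y) {G : X → X →L[ℝ] Y} {lam : X → ℝ} {φ : X → X}
    {x : X} (hG : DifferentiableAt ℝ G x) (hlam : DifferentiableAt ℝ lam x)
    (hφ : DifferentiableAt ℝ φ x) (hev : ∀ᶠ y in 𝓝 x, G y (φ y) = lam y • ι (φ y))
    (h0 : lam x = 0) {P : Y →L[ℝ] ℝ} (hP : ∀ v, P (G x v) = 0) (hP1 : P (ι (φ x)) = 1) (v : X) :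
    fderiv ℝ lam x v = P (fderiv ℝ G x v (φ x)) := by
  -- After applying `P`, both terms with `Dφ` disappear: on the left since `P` kills the range of `G
  -- x`, on the right since `lam x = 0`.
  have hL := P.hasFDerivAt.comp x (hG.hasFDerivAt.clm_apply hφ.hasFDerivAt)
  have hR := P.hasFDerivAt.comp x
    (hlam.hasFDerivAt.smul (ι.hasFDerivAt.comp x hφ.hasFDerivAt))
  have heq : (P ∘ fun y => G y (φ y)) =ᶠ[𝓝 x] P ∘ fun y => lam y • ι (φ y) := by
    filter_upwards [hev] with y hy
    simp [hy]
  have hu := congrArg (fun B : X →L[ℝ] ℝ => B v) (hL.unique (hR.congr_of_eventuallyEq heq))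
  simpa [hP, hP1, h0] using hu.symm

theorem theorem1
    {X : Type u} [NormedAddCommGroup X] [NormedSpace ℝ X] [CompleteSpace X]
    {Y : Type v} [NormedAddCommGroup Y] [NormedSpace ℝ Y] [CompleteSpace Y]
    (ι : X →L[ℝ] Y) (hι : Function.Injective ι)
    (U : Set X) (hU : IsOpen U) (F : X → Y) (hF : ContDiffOn ℝ 3 F U)
    (x : X) (hx : x ∈ U)
    (hfred : IsFredholmIndexZero (fderiv ℝ F x))
    (k : X) (hker : (fderiv ℝ F x).ker = Submodule.span ℝ {k})
    (hran : ι k ∉ (fderiv ℝ F x).range) :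
    ∃ r > 0,
      -- (1)
      (∀ T ∈ Metric.ball (fderiv ℝ F x) r,
        IsFredholmIndexZero T ∧ Module.finrank ℝ T.ker ≤ 1) ∧
      -- (2)
      ∃ (lam : (X →L[ℝ] Y) → ℝ) (φ : (X →L[ℝ] Y) → X),
        (∀ T ∈ Metric.ball (fderiv ℝ F x) r,
          IsEigenvector ι T (lam T) (φ T) ∧
          (∀ ψ : X, T ψ = lam T • ι ψ → ∃ c : ℝ, ψ = c • φ T) ∧
          ∀ z : ℂ, IsComplexEigenvalue ι T z → z ≠ (lam T : ℂ) → |lam T| < ‖z‖) ∧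
        AnalyticOnNhd ℝ lam (Metric.ball (fderiv ℝ F x) r) ∧
        (∃ ℓ : X →L[ℝ] ℝ, ∀ T ∈ Metric.ball (fderiv ℝ F x) r, ℓ (φ T) = 1) ∧
        AnalyticOnNhd ℝ φ (Metric.ball (fderiv ℝ F x) r) ∧
        -- (3)
        (∃ ρ > 0, Metric.ball x ρ ⊆ U ∧
          (∀ y ∈ Metric.ball x ρ, fderiv ℝ F y ∈ Metric.ball (fderiv ℝ F x) r) ∧
          ContDiffOn ℝ 2 (fun y => lam (fderiv ℝ F y)) (Metric.ball x ρ) ∧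
          ContDiffOn ℝ 2 (fun y => φ (fderiv ℝ F y)) (Metric.ball x ρ) ∧
          ∀ n : ℕ, ContDiffOn ℝ (n + 1) F U →
            ContDiffOn ℝ n (fun y => lam (fderiv ℝ F y)) (Metric.ball x ρ) ∧
            ContDiffOn ℝ n (fun y => φ (fderiv ℝ F y)) (Metric.ball x ρ)) ∧
        -- (4)
        (fderiv ℝ (fun y => lam (fderiv ℝ F y)) x (φ (fderiv ℝ F x)) ≠ 0 → IsFold U F x) := by
  have hk : k ≠ 0 := by
    rintro rfl
    exact hran (by rw [map_zero]; exact Submodule.zero_mem _)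
  obtain ⟨l, hl⟩ := SeparatingDual.exists_eq_one (R := ℝ) hk
  obtain ⟨r, hr, h1, lam, φ, h2, hlam, hl1, hφ, hlam0, hφ0⟩ :=
    exists_ball_smallest_eigenpair ι hfred hker hran hl
  have hcont : ContinuousOn (fderiv ℝ F) U := hF.continuousOn_fderiv_of_isOpen hU (by norm_num)
  have hnear : ∀ᶠ y in 𝓝 x, y ∈ U ∧ fderiv ℝ F y ∈ Metric.ball (fderiv ℝ F x) r :=
    (hU.eventually_mem hx).and ((hcont.continuousAt (hU.mem_nhds hx)).eventually
      (Metric.ball_mem_nhds _ hr))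
  obtain ⟨ρ, hρ, hball⟩ := Metric.eventually_nhds_iff_ball.1 hnear
  have hsmooth : ∀ n : ℕ, ContDiffOn ℝ (n + 1) F U →
      ContDiffOn ℝ n (fun y => lam (fderiv ℝ F y)) (Metric.ball x ρ) ∧
      ContDiffOn ℝ n (fun y => φ (fderiv ℝ F y)) (Metric.ball x ρ) := by
    intro n hn
    have hD : ContDiffOn ℝ n (fderiv ℝ F) (Metric.ball x ρ) :=
      (hn.fderiv_of_isOpen hU le_rfl).mono fun y hy => (hball y hy).1
    have hmaps : MapsTo (fderiv ℝ F) (Metric.ball x ρ) (Metric.ball (fderiv ℝ F x) r) :=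
      fun y hy => (hball y hy).2
    exact ⟨(hlam.contDiffOn Metric.isOpen_ball.uniqueDiffOn).comp hD hmaps, (hφ.contDiffOn Metric.isOpen_ball.uniqueDiffOn).comp hD hmaps⟩
  have hsm2 := hsmooth 2 (by
    rw [show (((2 : ℕ) : WithTop ℕ∞) + 1) = 3 by norm_num]
    exact hF)
  refine ⟨r, hr, h1, lam, φ, h2, hlam, ⟨l, hl1⟩, hφ, ⟨ρ, hρ, fun y hy => (hball y hy).1,
    fun y hy => (hball y hy).2, hsm2.1, hsm2.2, hsmooth⟩, ?_⟩
  rw [hφ0]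
  intro hder
  obtain ⟨A, hA⟩ := exists_equiv_add_smulRight hfred hker hran hl
  obtain ⟨E, hE⟩ := exists_equiv_prod_ker hl
  have hAv : ∀ v, A v = fderiv ℝ F x v + l v • ι k := fun v => by
    have := congrArg (fun B : X →L[ℝ] Y => B v) hA
    simpa using this
  have hTk : fderiv ℝ F x k = 0 := by
    have : k ∈ (fderiv ℝ F x).ker := by rw [hker]; exact Submodule.mem_span_singleton_self k
    exact this
  -- `A⁻¹ DF(x)` is the projection onto `l.ker` along `k`; in the coordinates `E` and `E ∘ A⁻¹`,
  -- `DF(x)` is therefore `(t, z) ↦ (0, z)`.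
  have hAT : ∀ v, A.symm (fderiv ℝ F x v) = v - l v • k := by
    intro v
    rw [A.symm_apply_eq, hAv]
    simp [hTk, hl]
  have hAk : A.symm (ι k) = k := by
    rw [A.symm_apply_eq, hAv, hTk, hl]
    simp
  have hEk : E.symm (1, 0) = k := by
    rw [E.symm_apply_eq]
    refine Prod.ext ?_ (Subtype.ext ?_)
    · rw [(hE k).1, hl]
    · rw [(hE k).2, hl]; simp
  have hxball : x ∈ Metric.ball x ρ := Metric.mem_ball_self hρ
  have hbn : Metric.ball x ρ ∈ 𝓝 x := Metric.ball_mem_nhds x hρ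
  have hformula := fderiv_eigenvalue_apply ι (G := fderiv ℝ F)
    (lam := fun y => lam (fderiv ℝ F y)) (φ := fun y => φ (fderiv ℝ F y)) (x := x)
    (((hF.contDiffAt (hU.mem_nhds hx)).fderiv_right (m := 2) (by norm_num)).differentiableAt
      (by norm_num))
    ((hsm2.1.contDiffAt hbn).differentiableAt (by norm_num))
    ((hsm2.2.contDiffAt hbn).differentiableAt (by norm_num))
    (by filter_upwards [hbn] with y hy using (h2 _ (hball y hy).2).1.2)
    hlam0 (P := l ∘L (A.symm : Y →L[ℝ] X)) (fun v => by simp [hAT, hl])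
    (by simp [hφ0, hAk, hl]) k
  rw [hformula, hφ0] at hder
  refine isFold_of_fderiv_fderiv_ne_zero hU hF hx E (A.symm.trans E) ?_ ?_
  · intro v
    refine Prod.ext ?_ (Subtype.ext ?_)
    · simp [hE, hAT, hl]
    · simp [hE, hAT, hl]
  · rw [hEk]
    simpa [hE] using hder
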